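/- Setting. A data set consists of $n\ge 0$ records $\mathcal N=\{1,\dots,n\}$ with values $x=(x_1,\dots,x_n)\in\mathcal D^n$; an unknown subset $\mathcal T\subseteq\mathcal N$ of the records is valid. Verifying a record $i$ reveals whether $i\in\mathcal T$. Let $f:\mathcal D^*\to[0,\infty)$ be a symmetric function on finite sequences over a set $\mathcal D$, write $x_S=(x_j)_{j\in S}$, and let $0\le\varepsilon<1$. A number $a$ is an accurate estimate of $b$ if $a\in[1-\varepsilon,\tfrac1{1-\varepsilon}]\cdot b$. A scheme is, for every $n$ and every $x\in\mathcal D^n$, a randomized adaptive procedure that verifies records and then stops; its only access to $\mathcal T$ is through the verifications. A *certification scheme* for $f$ uses $q(n,\varepsilon)$ verifications and fails with probability at most $1/3$ if for all $n$, $x\in\mathcal D^n$ and $\mathcal T\subseteq\mathcal N$ its expected number of verifications is at most $q(n,\varepsilon)$ (in particular, this covers schemes that always make at most $q(n,\varepsilon)$ verifications) and $$\mathbb P\big(f(x_{\mathcal N})\text{ is not an accurate estimate of }f(x_{\mathcal T})\ \text{ and no invalid record is found}\big)\le \tfrac13 .$$ A *weak-correction scheme* for $f$ has verification complexity $v(n)$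 and fails with probability at most $\delta$ if for all $n$, $x\in\mathcal D^n$ and $\mathcal T\subseteq\mathcal N$ it outputs a real number that is an accurate estimate of $f(x_{\mathcal T})$ with probability at least $1-\delta$, and in every execution its total number of verifications is at most $(k+1)\,v(n)$, where $k$ is the number of distinct invalid records found in that execution. Theorem. There is an absolute constant $C>0$ such that the following holds for all $\mathcal D$, $f$ and $\varepsilon$ as above. Suppose that $f$ has a certification scheme that uses $q(n,\varepsilon)$ verifications and fails with probability at most $1/3$, where $q(n,\varepsilon)\ge0$ is nondecreasing in $n$. Then for every $0<\delta\le 1/2$ there is a weak-correction scheme for $f$ with verification complexity at most $C\,q(n,\varepsilon)\log(1/\delta)$ that outputs an accurate estimate of $f(x_{\mathcal T})$ and fails with probability at most $\delta$. -/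

import Mathlib

open scoped NNReal ENNReal

/-- A deterministic adaptive verification procedure on records indexed by `ι` with outputs in `α`:
it either stops with an output, or verifies the record `i` and continues with `ifValid` or
`ifInvalid`, according to whether the record turned out to be valid or invalid.
A randomized procedure is a probability distribution (`PMF`) on such trees. -/
inductive VerTree (ι : Type*) (α : Type*) where
  | output (a : α) : VerTree ι α
  | verify (i : ι) (ifValid ifInvalid : VerTree ι α) : VerTree ι α

namespace VerTree

variable {ι α : Type*} [DecidableEq ι]

/-- The output of the procedure when the set of valid records is `T`. -/
def result (T : Finset ι) : VerTree ι α → α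
  | output a => a
  | verify i l r => if i ∈ T then l.result T else r.result T

/-- The records that the procedure verifies, in order and with repetitions, when the set of valid
records is `T`. -/
def verified (T : Finset ι) : VerTree ι α → List ι
  | output _ => []
  | verify i l r => i :: (if i ∈ T then l.verified T else r.verified T)

/-- The number of verifications (repeated verifications of a record are counted each time). -/
def cost (T : Finset ι) (t : VerTree ι α) : ℕ := (t.verified T).length

/-- The set of invalid records that the procedure finds. -/
def found (T : Finset ι) (t : VerTree ι α) : Finset ι := (t.verified T).toFinset \ T

end VerTree

/-- The data `x_S` of the records in `S`, up to order. Symmetric functions on finite sequences over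
`D` are the functions on `Multiset D`. -/
def subData {D : Type*} {n : ℕ} (x : Fin n → D) (S : Finset (Fin n)) : Multiset D := S.val.map x

/-- The estimate `a` lies in `[1 - ε, 1 / (1 - ε)] * b`. -/
def IsAccurate (ε a b : ℝ) : Prop := (1 - ε) * b ≤ a ∧ a ≤ 1 / (1 - ε) * b

/-- `cert` is a certification scheme for `f` with accuracy `ε` that uses `q n` verifications on `n`
records and fails with probability at most `δ`. For every input `x` and every set `T` of valid
records (which the scheme does not see), the expected number of verifications is at most `q n`, and
the probability that `f(x_N)` is not accurate for `f(x_T)` and yet no invalid record is found is at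
most `δ`. (`p.toOuterMeasure s` is the probability of the event `s` under `p`.) -/
def IsCertificationScheme {D : Type*} (f : Multiset D → ℝ≥0) (ε : ℝ) (q : ℕ → ℝ≥0) (δ : ℝ)
    (cert : ∀ n : ℕ, (Fin n → D) → PMF (VerTree (Fin n) Unit)) : Prop :=
  ∀ (n : ℕ) (x : Fin n → D) (T : Finset (Fin n)),
    (∑' t, cert n x t * (t.cost T : ℝ≥0∞)) ≤ (q n : ℝ≥0∞) ∧
    (cert n x).toOuterMeasure
      {t | ¬ IsAccurate ε (f (subData x Finset.univ)) (f (subData x T)) ∧ t.found T = ∅}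
      ≤ ENNReal.ofReal δ

/-- `corr` is a weak-correction scheme for `f` with accuracy `ε`, verification complexity `v n` on
`n` records, and failure probability at most `δ`. For every input `x` and every set `T` of valid
records, whatever the random choices are, the total number of verifications is at most
`(k + 1) * v n`, where `k` is the number of (distinct) invalid records found, and the output is an
accurate estimate of `f(x_T)` except with probability at most `δ`. -/
def IsWeakCorrectionScheme {D : Type*} (f : Multiset D → ℝ≥0) (ε : ℝ) (v : ℕ → ℝ) (δ : ℝ)
    (corr : ∀ n : ℕ, (Fin n → D) → PMF (VerTree (Fin n) ℝ)) : Prop :=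
  ∀ (n : ℕ) (x : Fin n → D) (T : Finset (Fin n)),
    (∀ t ∈ (corr n x).support, (t.cost T : ℝ) ≤ ((t.found T).card + 1) * v n) ∧
    (corr n x).toOuterMeasure {t | ¬ IsAccurate ε (t.result T) (f (subData x T))}
      ≤ ENNReal.ofReal δ

/-! Run the certification scheme again and again on the set `S` of records not yet known to be
invalid, each time recording `f(x_S)`. A run ends after `Q ≈ 6q` verifications or at its first
invalid record, which is deleted from `S` and pays for `m` more runs. The output is the median of
the recorded values. If `f(x_S)` is inaccurate, a run finds an invalid record with probability at
least `1 - 1/3 - 1/6 = 1/2` (certification failure plus Markov for the cut-off). Hence the potential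
`(5/6)^(runs left + accurate values - inaccurate values)` does not increase on average. At the end
it is at least 1 whenever the median is inaccurate, so its initial value `(5/6)^m` bounds the
failure probability (`correct_result`). The cost is charged to the runs (`correct_cost`). -/

/-- The upper median of a list of reals. -/
noncomputable def listMedian (L : List ℝ) : ℝ :=
  sSup {a | L.length < 2 * L.countP (fun y => decide (a ≤ y))}

/-- If a strict majority of the entries lie in `[lo, hi]`, then so does the median. -/
theorem listMedian_mem_Icc {L : List ℝ} {lo hi : ℝ} {good : ℝ → Bool}
    (hgood : ∀ y, good y = true → lo ≤ y ∧ y ≤ hi)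
    (h : L.countP (fun y => !good y) < L.countP good) :
    lo ≤ listMedian L ∧ listMedian L ≤ hi := by
  have hlen : L.length = L.countP good + L.countP (fun y => !good y) := by
    rw [List.length_eq_countP_add_countP good]
    congr 2
    ext y
    simp
  have hlo : lo ∈ {a | L.length < 2 * L.countP (fun y => decide (a ≤ y))} := by
    have : L.countP good ≤ L.countP (fun y => decide (lo ≤ y)) :=
      List.countP_mono_left fun y _ hy => by simpa using (hgood y hy).1
    simp only [Set.mem_ofPred_eq]
    omega
  have hub : ∀ a ∈ {a | L.length < 2 * L.countP (fun y => decide (a ≤ y))}, a ≤ hi := by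
    intro a ha
    by_contra hlt
    have : L.countP (fun y => decide (a ≤ y)) ≤ L.countP (fun y => !good y) :=
      List.countP_mono_left fun y _ hy => by
        have hy : a ≤ y := by simpa using hy
        simpa using fun hp => hlt (hy.trans (hgood y hp).2)
    simp only [Set.mem_ofPred_eq] at ha
    omega
  -- The set is nonempty and bounded above, so the default value of `sSup` plays no role.
  exact ⟨le_csSup ⟨hi, hub⟩ hlo, csSup_le ⟨lo, hlo⟩ hub⟩

/-! ### Truncated runs with random continuations -/

namespace VerTree

variable {ι κ α β : Type*}

/-- Follow the procedure, with its records renamed by `e`, for at most `q` verifications and until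
the first invalid record. Continue with `miss` if no invalid record was found, and with `hit j` if
the invalid record `j` was found. -/
noncomputable def graft (e : κ → ι) (miss : PMF (VerTree ι α)) (hit : κ → PMF (VerTree ι α)) :
    ℕ → VerTree κ β → PMF (VerTree ι α)
  | _, output _ => miss
  | 0, verify _ _ _ => miss
  -- The run's own invalid branch is dropped. Both continuations are drawn, but any given `T`
  -- executes only one, so their joint law is immaterial.
  | q + 1, verify j l _ =>
    (graft e miss hit q l).bind fun l' => (hit j).bind fun r' => PMF.pure (verify (e j) l' r')

variable [DecidableEq ι]

/-- The verifications of a grafted procedure stay in `S`, and their number is controlled by that of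
the continuations. -/
theorem graft_cost {e : κ → ι} {miss : PMF (VerTree ι α)} {hit : κ → PMF (VerTree ι α)}
    {T S : Finset ι} {c d : ℕ} (he : ∀ j, e j ∈ S)
    (hmiss : ∀ t ∈ miss.support, (t.verified T).toFinset ⊆ S ∧ t.cost T ≤ c + d * (t.found T).card)
    (hhit : ∀ j, ∀ t ∈ (hit j).support,
      (t.verified T).toFinset ⊆ S.erase (e j) ∧ t.cost T ≤ c + d + d * (t.found T).card)
    (q : ℕ) (t : VerTree κ β) :
    ∀ t' ∈ (graft e miss hit q t).support,
      (t'.verified T).toFinset ⊆ S ∧ t'.cost T ≤ q + (c + d * (t'.found T).card) := by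
  induction q, t using graft.induct with
  | case1 q a =>
    intro t' ht'
    rw [graft] at ht'
    exact ⟨(hmiss t' ht').1, (hmiss t' ht').2.trans (Nat.le_add_left _ _)⟩
  | case2 j l r =>
    intro t' ht'
    rw [graft] at ht'
    exact ⟨(hmiss t' ht').1, (hmiss t' ht').2.trans (Nat.le_add_left _ _)⟩
  | case3 q j l r ih =>
    intro t' ht'
    rw [graft] at ht'
    simp only [PMF.mem_support_bind_iff, PMF.mem_support_pure_iff] at ht'
    obtain ⟨l', hl', r', hr', rfl⟩ := ht'
    by_cases hj : e j ∈ T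
    · obtain ⟨h1, h2⟩ := ih l' hl'
      have hf : (verify (e j) l' r').found T = l'.found T := by
        simp [found, verified, hj, Finset.insert_sdiff_of_mem]
      have hc : (verify (e j) l' r').cost T = l'.cost T + 1 := by
        simp [cost, verified, hj]
      refine ⟨?_, by rw [hf, hc]; omega⟩
      simp only [verified, hj, if_true, List.toFinset_cons]
      exact Finset.insert_subset (he j) h1
    · obtain ⟨h1, h2⟩ := hhit j r' hr'
      have hf : (verify (e j) l' r').found T = insert (e j) (r'.found T) := by
        simp [found, verified, hj, Finset.insert_sdiff_of_notMem]
      -- After the hit, `e j` is never verified again, so it adds one to the number of distinct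
      -- invalid records and pays the extra `d`.
      have hn : e j ∉ r'.found T := fun h =>
        Finset.notMem_erase (e j) S (h1 (Finset.sdiff_subset h))
      have hc : (verify (e j) l' r').cost T = r'.cost T + 1 := by
        simp [cost, verified, hj]
      refine ⟨?_, ?_⟩
      · simp only [verified, hj, if_false, List.toFinset_cons]
        exact Finset.insert_subset (he j) (h1.trans (Finset.erase_subset _ _))
      · rw [hf, hc, Finset.card_insert_of_notMem hn, mul_add, mul_one]
        omega

/-- A bound for the probability of a bad output of a grafted procedure; it improves if the
procedure finds an invalid record before it is cut off. -/
theorem graft_result [DecidableEq κ] {e : κ → ι} {miss : PMF (VerTree ι α)} {hit : κ → PMF (VerTree ι α)}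
    {T : Finset ι} {T' : Finset κ} (hT : ∀ j, j ∈ T' ↔ e j ∈ T) {s : Set α} {A B : ℝ≥0∞}
    (hBA : B ≤ A) (hmiss : miss.toOuterMeasure {t | t.result T ∈ s} ≤ A)
    (hhit : ∀ j, j ∉ T' → (hit j).toOuterMeasure {t | t.result T ∈ s} ≤ B)
    (q : ℕ) (t : VerTree κ β) :
    (graft e miss hit q t).toOuterMeasure {t | t.result T ∈ s} ≤ A ∧
      (t.cost T' ≤ q → t.found T' ≠ ∅ →
        (graft e miss hit q t).toOuterMeasure {t | t.result T ∈ s} ≤ B) := by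
  induction q, t using graft.induct with
  | case1 q a =>
    rw [graft]
    exact ⟨hmiss, fun _ h => absurd (by simp [found, verified]) h⟩
  | case2 j l r =>
    rw [graft]
    exact ⟨hmiss, fun h => absurd h (by simp [cost, verified])⟩
  | case3 q j l r ih =>
    rw [graft]
    by_cases hj : j ∈ T'
    · have key : ((graft e miss hit q l).bind fun l' => (hit j).bind fun r' =>
          PMF.pure (verify (e j) l' r')).toOuterMeasure {t | t.result T ∈ s}
          = (graft e miss hit q l).toOuterMeasure {t | t.result T ∈ s} := by
        rw [PMF.toOuterMeasure_bind_apply, PMF.toOuterMeasure_apply]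
        refine tsum_congr fun l' => ?_
        have : ∀ r', (verify (e j) l' r').result T = l'.result T := fun r' => by
          simp [result, (hT j).1 hj]
        by_cases hl : l'.result T ∈ s <;>
          simp [PMF.toOuterMeasure_bind_apply, PMF.toOuterMeasure_pure_apply, this, hl,
            PMF.tsum_coe]
      rw [key]
      refine ⟨ih.1, fun h1 h2 => ih.2 ?_ ?_⟩
      · simpa [cost, verified, hj] using h1
      · simpa [found, verified, hj, Finset.insert_sdiff_of_mem] using h2
    · have key : ((graft e miss hit q l).bind fun l' => (hit j).bind fun r' =>
          PMF.pure (verify (e j) l' r')).toOuterMeasure {t | t.result T ∈ s}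
          = (hit j).toOuterMeasure {t | t.result T ∈ s} := by
        have : ∀ l' r' : VerTree ι α, (verify (e j) l' r').result T = r'.result T := fun l' r' => by
          simp [result, mt (hT j).2 hj]
        have hr : ∀ l' : VerTree ι α, ((hit j).bind fun r' =>
            PMF.pure (verify (e j) l' r')).toOuterMeasure {t | t.result T ∈ s}
            = (hit j).toOuterMeasure {t | t.result T ∈ s} := fun l' => by
          rw [PMF.toOuterMeasure_bind_apply, PMF.toOuterMeasure_apply]
          refine tsum_congr fun r' => ?_
          by_cases hr : r'.result T ∈ s <;> simp [PMF.toOuterMeasure_pure_apply, this, hr]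
        rw [PMF.toOuterMeasure_bind_apply]
        simp only [hr, ENNReal.tsum_mul_right, PMF.tsum_coe, one_mul]
      rw [key]
      exact ⟨(hhit j hj).trans hBA, fun _ _ => hhit j hj⟩

end VerTree

/-! ### Probability estimates -/

/-- Markov's inequality for a natural-number valued function under a `PMF`. -/
theorem PMF.toOuterMeasure_lt_le {Ω : Type*} (p : PMF Ω) (g : Ω → ℕ) {a : ℝ≥0} {N : ℕ}
    (hp : ∑' t, p t * (g t : ℝ≥0∞) ≤ a) (hN : 6 * a ≤ N + 1) :
    p.toOuterMeasure {t | N < g t} ≤ ENNReal.ofReal (1 / 6) := by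
  -- For integers, `N < g t` means `N + 1 ≤ g t`; this allows rounding the cut-off down.
  have h1 : p.toOuterMeasure {t | N < g t} * ((N + 1 : ℕ) : ℝ≥0∞) ≤ a := by
    refine le_trans ?_ hp
    rw [PMF.toOuterMeasure_apply, ← ENNReal.tsum_mul_right]
    refine ENNReal.tsum_le_tsum fun t => ?_
    simp only [Set.indicator_apply, Set.mem_ofPred_eq]
    split_ifs with h
    · gcongr
      exact h
    · simp
  have h2 : (a : ℝ≥0∞) ≤ ENNReal.ofReal (1 / 6) * ((N + 1 : ℕ) : ℝ≥0∞) := by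
    rw [← ENNReal.ofReal_natCast, ← ENNReal.ofReal_mul (by norm_num), ← ENNReal.ofReal_coe_nnreal]
    refine ENNReal.ofReal_le_ofReal ?_
    have : (6 : ℝ) * a ≤ N + 1 := by exact_mod_cast hN
    push_cast
    linarith
  exact (ENNReal.mul_le_mul_iff_left (by simp) (by simp)).1 (h1.trans h2)

/-- A mixture of distributions that assign to an event mass at most `A`, and mass at most `B ≤ A`
with probability at least `1 / 2`. -/
theorem PMF.toOuterMeasure_bind_le_half {Ω Ω' : Type*} (p : PMF Ω) (g : Ω → PMF Ω') {s : Set Ω'}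
    {N : Set Ω} {A B : ℝ} (hB : 0 ≤ B) (hBA : B ≤ A)
    (hN : p.toOuterMeasure N ≤ ENNReal.ofReal (1 / 2))
    (hA : ∀ t, (g t).toOuterMeasure s ≤ ENNReal.ofReal A)
    (hNB : ∀ t, t ∉ N → (g t).toOuterMeasure s ≤ ENNReal.ofReal B) :
    (p.bind g).toOuterMeasure s ≤ ENNReal.ofReal ((A + B) / 2) := by
  have hle : (p.bind g).toOuterMeasure s ≤
      ENNReal.ofReal B + p.toOuterMeasure N * ENNReal.ofReal (A - B) := by
    rw [PMF.toOuterMeasure_bind_apply, PMF.toOuterMeasure_apply, ← ENNReal.tsum_mul_right]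
    calc ∑' t, p t * (g t).toOuterMeasure s
        ≤ ∑' t, (p t * ENNReal.ofReal B + N.indicator p t * ENNReal.ofReal (A - B)) := by
          refine ENNReal.tsum_le_tsum fun t => ?_
          by_cases ht : t ∈ N
          · rw [Set.indicator_of_mem ht, ← mul_add, ← ENNReal.ofReal_add hB (sub_nonneg.2 hBA),
              add_sub_cancel]
            gcongr
            exact hA t
          · rw [Set.indicator_of_notMem ht, zero_mul, add_zero]
            gcongr
            exact hNB t ht
      _ = _ := by rw [ENNReal.tsum_add, ENNReal.tsum_mul_right, PMF.tsum_coe, one_mul]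
  refine hle.trans ?_
  calc _ ≤ ENNReal.ofReal B + ENNReal.ofReal (1 / 2) * ENNReal.ofReal (A - B) := by gcongr
    _ = _ := by
      rw [← ENNReal.ofReal_mul (by norm_num), ← ENNReal.ofReal_add hB (by linarith)]
      congr 1
      ring

/-! ### The correction procedure and its analysis -/

section Correction

variable {D : Type*}

/-- The enumeration of the records in `S`. -/
noncomputable def recordOf {n : ℕ} (S : Finset (Fin n)) (j : Fin S.card) : Fin n :=
  (S.equivFin.symm j : Fin n)

theorem recordOf_mem {n : ℕ} (S : Finset (Fin n)) (j : Fin S.card) : recordOf S j ∈ S :=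
  (S.equivFin.symm j).2

theorem recordOf_injective {n : ℕ} (S : Finset (Fin n)) : Function.Injective (recordOf S) :=
  Subtype.val_injective.comp S.equivFin.symm.injective

theorem map_recordOf_univ {n : ℕ} (S : Finset (Fin n)) :
    Finset.univ.map ⟨recordOf S, recordOf_injective S⟩ = S := by
  ext i
  simp only [Finset.mem_map, Finset.mem_univ, true_and, Function.Embedding.coeFn_mk]
  constructor
  · rintro ⟨j, rfl⟩
    exact recordOf_mem S j
  · intro hi
    exact ⟨S.equivFin ⟨i, hi⟩, by simp [recordOf]⟩

theorem subData_recordOf {n : ℕ} (x : Fin n → D) (S : Finset (Fin n)) (U : Finset (Fin S.card)) :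
    subData (x ∘ recordOf S) U = subData x (U.map ⟨recordOf S, recordOf_injective S⟩) := by
  simp [subData, Finset.map_val, Multiset.map_map]

/-- The correction procedure in the state where the records outside `S` are known to be invalid,
`b` further runs of the certification scheme are paid for, and `L` lists the values of `f` on the
data sets certified so far. Each run is cut off after `Q` verifications, and each invalid record
pays for `m` further runs. -/
noncomputable def correct (f : Multiset D → ℝ≥0)
    (cert : ∀ n : ℕ, (Fin n → D) → PMF (VerTree (Fin n) Unit)) (Q m : ℕ) {n : ℕ} (x : Fin n → D)
    (S : Finset (Fin n)) (b : ℕ) (L : List ℝ) : PMF (VerTree (Fin n) ℝ) :=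
  match b with
  | 0 => PMF.pure (.output (listMedian L))
  | b + 1 =>
    (cert S.card (x ∘ recordOf S)).bind fun t =>
      VerTree.graft (recordOf S) (correct f cert Q m x S b (f (subData x S) :: L))
        (fun j => correct f cert Q m x (S.erase (recordOf S j)) (b + m) (f (subData x S) :: L)) Q t
-- A hit raises the number of runs but shrinks `S`, hence the lexicographic order.
termination_by (S.card, b)
decreasing_by
  · exact Prod.Lex.right _ (Nat.lt_succ_self b)
  · exact Prod.Lex.left _ _ (Finset.card_erase_lt_of_mem (recordOf_mem S j))

variable {f : Multiset D → ℝ≥0} {cert : ∀ n : ℕ, (Fin n → D) → PMF (VerTree (Fin n) Unit)}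
  {Q m n : ℕ} {x : Fin n → D}

/-- The verifications that remain are paid for by the remaining runs and the invalid records. -/
theorem correct_cost (T S : Finset (Fin n)) (b : ℕ) (L : List ℝ) :
    ∀ t ∈ (correct f cert Q m x S b L).support,
      (t.verified T).toFinset ⊆ S ∧ t.cost T ≤ Q * b + Q * m * (t.found T).card := by
  induction S, b, L using correct.induct (f := f) (m := m) (x := x) with
  | case1 S L =>
    intro t ht
    rw [correct, PMF.mem_support_pure_iff] at ht
    subst ht
    simp [VerTree.verified, VerTree.cost]
  | case2 S L b ih1 ih2 =>
    intro t ht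
    rw [correct, PMF.mem_support_bind_iff] at ht
    obtain ⟨t₀, -, ht⟩ := ht
    have := VerTree.graft_cost (recordOf_mem S) ih1
      (fun j t ht => ⟨(ih2 j t ht).1, (ih2 j t ht).2.trans (by rw [mul_add])⟩) Q t₀ t ht
    refine ⟨this.1, this.2.trans ?_⟩
    rw [Nat.mul_succ]
    omega

/-- The probability of an inaccurate output decreases exponentially in the number of remaining runs
plus the number of runs so far whose data set had an accurate value, minus the number of the other
runs so far. -/
theorem correct_result {ε : ℝ} {q : ℕ → ℝ≥0} (hcert : IsCertificationScheme f ε q (1 / 3) cert)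
    (hq : Monotone q) (hQ : 6 * q n ≤ Q + 1) (hm : (5 / 6 : ℝ) ^ m ≤ 7 / 18) (T S : Finset (Fin n))
    (hTS : T ⊆ S) {good : ℝ → Bool}
    (hgood : ∀ a, good a = true ↔ IsAccurate ε a (f (subData x T))) (b : ℕ) (L : List ℝ) :
    (correct f cert Q m x S b L).toOuterMeasure
        {t | t.result T ∈ {a | ¬ IsAccurate ε a (f (subData x T))}} ≤
      ENNReal.ofReal ((5 / 6) ^ b *
        ((5 / 6) ^ L.countP good * (6 / 5) ^ L.countP (fun a => !good a))) := by
  induction S, b, L using correct.induct (f := f) (m := m) (x := x) with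
  | case1 S L =>
    rw [correct, PMF.toOuterMeasure_pure_apply]
    split_ifs with h
    -- An inaccurate median rules out a strict accurate majority, so the potential is at least 1.
    · have hle : L.countP good ≤ L.countP (fun a => !good a) :=
        not_lt.1 fun hlt => h (listMedian_mem_Icc (fun y hy => (hgood y).1 hy) hlt)
      rw [ENNReal.one_le_ofReal, pow_zero, one_mul]
      calc (1 : ℝ) = (5 / 6) ^ L.countP good * (6 / 5) ^ L.countP good := by
            rw [← mul_pow]; norm_num
        _ ≤ _ := by
            gcongr
            norm_num
    · simp
  | case2 S L b ih1 ih2 =>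
    rw [correct]
    have ih1 := ih1 hTS
    set T' : Finset (Fin S.card) := Finset.univ.filter fun j => recordOf S j ∈ T with hT'
    have hT : ∀ j, j ∈ T' ↔ recordOf S j ∈ T := fun j => by simp [hT']
    have ih2 := fun j (hj : j ∉ T') => ih2 j fun i hi =>
      Finset.mem_erase.2 ⟨fun h => hj ((hT j).2 (h ▸ hi)), hTS hi⟩
    obtain ⟨hcost, hfail⟩ := hcert S.card (x ∘ recordOf S) T'
    have hmap : T'.map ⟨recordOf S, recordOf_injective S⟩ = T := by
      ext i
      constructor
      · intro hi
        obtain ⟨j, hj, rfl⟩ := Finset.mem_map.1 hi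
        exact (hT j).1 hj
      · intro hi
        have hS := hTS hi
        rw [← map_recordOf_univ S] at hS
        obtain ⟨j, -, rfl⟩ := Finset.mem_map.1 hS
        exact Finset.mem_map.2 ⟨j, (hT j).2 hi, rfl⟩
    rw [subData_recordOf, subData_recordOf, map_recordOf_univ, hmap] at hfail
    generalize hu : L.countP good = u at ih1 ih2 ⊢
    generalize hw : L.countP (fun a => !good a) = w at ih1 ih2 ⊢
    have hm1 : (5 / 6 : ℝ) ^ m ≤ 1 := hm.trans (by norm_num)
    -- With an accurate value, the run used up is offset by the accurate value gained; a hit only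
    -- helps.
    by_cases hacc : good (f (subData x S)) = true
    · simp only [List.countP_cons, hacc, if_true, Bool.not_true, Bool.false_eq_true, if_false,
        add_zero, hu, hw] at ih1 ih2
      rw [PMF.toOuterMeasure_bind_apply]
      have hBA : ENNReal.ofReal ((5 / 6) ^ (b + m) * ((5 / 6) ^ (u + 1) * (6 / 5) ^ w)) ≤
          ENNReal.ofReal ((5 / 6) ^ b * ((5 / 6) ^ (u + 1) * (6 / 5) ^ w)) := by
        refine ENNReal.ofReal_le_ofReal ?_
        refine mul_le_mul_of_nonneg_right ?_ (by positivity)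
        rw [pow_add]
        exact mul_le_of_le_one_right (by positivity) hm1
      calc _ ≤ ∑' t, cert S.card (x ∘ recordOf S) t *
            ENNReal.ofReal ((5 / 6) ^ b * ((5 / 6) ^ (u + 1) * (6 / 5) ^ w)) := by
            refine ENNReal.tsum_le_tsum fun t => ?_
            gcongr
            exact (VerTree.graft_result hT hBA ih1 ih2 Q t).1
        _ = _ := by
            rw [ENNReal.tsum_mul_right, PMF.tsum_coe, one_mul]
            rw [Nat.succ_eq_add_one]
            congr 1
            ring
    · have hna := mt (hgood _).2 hacc
      simp only [List.countP_cons, Bool.not_eq_true] at hacc ih1 ih2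
      simp only [hacc, if_true, Bool.not_false, Bool.false_eq_true, if_false, add_zero,
        hu, hw] at ih1 ih2
      simp only [hna, not_false_eq_true, true_and] at hfail
      have hBA : (5 / 6 : ℝ) ^ (b + m) * ((5 / 6) ^ u * (6 / 5) ^ (w + 1)) ≤
          (5 / 6) ^ b * ((5 / 6) ^ u * (6 / 5) ^ (w + 1)) := by
        refine mul_le_mul_of_nonneg_right ?_ (by positivity)
        rw [pow_add]
        exact mul_le_of_le_one_right (by positivity) hm1
      have hmarkov : (cert S.card (x ∘ recordOf S)).toOuterMeasure {t | Q < t.cost T'} ≤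
          ENNReal.ofReal (1 / 6) := by
        refine PMF.toOuterMeasure_lt_le _ _ hcost (le_trans ?_ hQ)
        gcongr
        -- Monotonicity of `q` lets one cut-off, chosen for `n`, serve every subset `S`.
        exact hq (by simpa using Finset.card_le_univ S)
      have hN : (cert S.card (x ∘ recordOf S)).toOuterMeasure
          ({t | Q < t.cost T'} ∪ {t | t.found T' = ∅}) ≤ ENNReal.ofReal (1 / 2) := by
        refine (MeasureTheory.measure_union_le _ _).trans ((add_le_add hmarkov hfail).trans ?_)
        rw [← ENNReal.ofReal_add (by norm_num) (by norm_num)]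
        exact ENNReal.ofReal_le_ofReal (by norm_num)
      have hg := VerTree.graft_result (β := Unit) hT (ENNReal.ofReal_le_ofReal hBA) ih1 ih2 Q
      refine (PMF.toOuterMeasure_bind_le_half _ _ (by positivity) hBA hN (fun t => (hg t).1)
        fun t ht => (hg t).2 ?_ ?_).trans (ENNReal.ofReal_le_ofReal ?_)
      · exact not_lt.1 fun h => ht (Or.inl h)
      · exact fun h => ht (Or.inr h)
      -- A miss multiplies the potential by `(6/5)^2`, a hit by `(6/5)^2 (5/6)^m`. Their mean is at
      -- most 1 exactly when `(5/6)^m ≤ 7/18`.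
      · have e1 : (5 / 6 : ℝ) ^ b * ((5 / 6) ^ u * (6 / 5) ^ (w + 1)) +
            (5 / 6) ^ (b + m) * ((5 / 6) ^ u * (6 / 5) ^ (w + 1)) =
            (5 / 6) ^ b * ((5 / 6) ^ u * (6 / 5) ^ w) * (6 / 5 * (1 + (5 / 6) ^ m)) := by
          ring
        have e2 : (5 / 6 : ℝ) ^ (b + 1) * ((5 / 6) ^ u * (6 / 5) ^ w) =
            (5 / 6) ^ b * ((5 / 6) ^ u * (6 / 5) ^ w) * (5 / 6) := by
          ring
        rw [e1, e2, mul_div_assoc]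
        refine mul_le_mul_of_nonneg_left ?_ (by positivity)
        linarith

end Correction

theorem mainTheorem3 :
    ∃ C : ℝ, 0 < C ∧
      ∀ (D : Type*) (f : Multiset D → ℝ≥0) (q : ℕ → ℝ → ℝ≥0) (ε : ℝ),
        0 ≤ ε → ε < 1 → Monotone (fun n => q n ε) →
        (∃ cert : ∀ n : ℕ, (Fin n → D) → PMF (VerTree (Fin n) Unit),
          IsCertificationScheme f ε (fun n => q n ε) (1 / 3) cert) →
        ∀ δ : ℝ, 0 < δ → δ ≤ 1 / 2 →
          ∃ corr : ∀ n : ℕ, (Fin n → D) → PMF (VerTree (Fin n) ℝ),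
            IsWeakCorrectionScheme f ε (fun n => C * (q n ε * Real.log (1 / δ))) δ corr := by
  classical
  -- `84 = 6 * 14`, from `Q ≤ 6q` and `m ≤ 14 l`.
  refine ⟨84, by norm_num, fun D f q ε _ _ hq ⟨cert, hcert⟩ δ hδ hδ2 => ?_⟩
  set l := Real.log (1 / δ) with hl
  have hl2 : 1 / 2 ≤ l := by
    have h1 : Real.log 2 ≤ l := by
      refine Real.log_le_log (by norm_num) ?_
      rw [le_div_iff₀ hδ]
      linarith
    have := Real.log_two_gt_d9
    linarith
  set m := ⌈12 * l⌉₊ with hm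
  have hm_ge : 12 * l ≤ m := Nat.le_ceil _
  have hm_le : (m : ℝ) ≤ 14 * l := by
    have := Nat.ceil_lt_add_one (show 0 ≤ 12 * l by linarith)
    linarith
  -- The square serves twice: `δ² ≤ 1/4 ≤ 7/18` for the potential argument and `δ² ≤ δ` for the
  -- final failure bound.
  have hpow : (5 / 6 : ℝ) ^ m ≤ δ * δ := by
    have h56 : Real.log (5 / 6) ≤ -(1 / 6) := by
      have := Real.log_le_sub_one_of_pos (show (0 : ℝ) < 5 / 6 by norm_num)
      linarith
    have hlδ : l = -Real.log δ := by rw [hl, one_div, Real.log_inv]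
    rw [← Real.log_le_log_iff (by positivity) (by positivity), Real.log_pow,
      Real.log_mul hδ.ne' hδ.ne']
    nlinarith
  refine ⟨fun n x => correct f cert ⌊6 * q n ε⌋₊ m x Finset.univ m [], fun n x T => ⟨?_, ?_⟩⟩
  · intro t ht
    have h := (correct_cost T Finset.univ m [] t ht).2
    have hQ : ((⌊6 * q n ε⌋₊ : ℕ) : ℝ) ≤ 6 * q n ε := by
      exact_mod_cast Nat.floor_le (a := 6 * q n ε) zero_le
    have h' : (t.cost T : ℝ) ≤ (⌊6 * q n ε⌋₊ : ℝ) * m * ((t.found T).card + 1) := by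
      have : (t.cost T : ℝ) ≤ (⌊6 * q n ε⌋₊ : ℝ) * m + (⌊6 * q n ε⌋₊ : ℝ) * m * (t.found T).card := by
        exact_mod_cast h
      linarith
    calc (t.cost T : ℝ) ≤ (⌊6 * q n ε⌋₊ : ℝ) * m * ((t.found T).card + 1) := h'
      _ ≤ (6 * q n ε) * (14 * l) * ((t.found T).card + 1) := by gcongr
      _ = _ := by ring
  · refine (correct_result hcert hq (Nat.lt_floor_add_one _).le (hpow.trans ?_) T Finset.univ
      (Finset.subset_univ T) (fun _ => decide_eq_true_iff) m []).trans (ENNReal.ofReal_le_ofReal ?_)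
    · nlinarith
    · simp only [List.countP_nil, pow_zero, mul_one]
      nlinarith
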